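/- Let $X$ be a complex Banach space, let $I=\mathbb{R}$ or $I=[0,\infty)$, and let $f:I\to X$ be continuous. A set $S$ is relatively dense in $I$ if there is $l>0$ such that every closed subinterval of $I$ of length $l$ meets $S$. The function $f$ is called almost periodic if for every $\varepsilon>0$ the set of all $\tau\in I\setminus\{0\}$ with $\|f(t+\tau)-f(t)\|\le\varepsilon$ for all $t\in I$ is relatively dense in $I$, and almost anti-periodic if for every $\varepsilon>0$ the set of all $\tau\in I\setminus\{0\}$ with $\|f(t+\tau)+f(t)\|\le\varepsilon$ for all $t\in I$ is relatively dense in $I$. Let $AP(I:X)$ be the space of almost periodic functions $I\to X$ with the sup-norm, and let $ANP(I:X)$ be the closure in $AP(I:X)$ of the complex linear span of the almost anti-periodic functions $I\to X$. For $f\in AP(I:X)$ and $r\in\mathbb{R}$ let $$P_r(f)=\lim_{t\to\infty}\frac1t\int_0^t e^{-irs}f(s)\,ds$$ (the limit exists), let $\sigma(f)=\{r\in\mathbb{R}: P_r(f)\ne 0\}$, and for $\emptyset\ne\Lambda\subseteq\mathbb{R}$ let $AP_\Lambda(I:X)=\{f\in AP(I:X):\sigma(f)\subseteq\Lambda\}$.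 **Corollary 2.6.** Let $f\in AP(I:X)$ and let $\emptyset\ne\Lambda\subseteq\mathbb{R}$. Then $f\in AP_\Lambda(I:X)$ (that is, $\sigma(f)\subseteq\Lambda$) if and only if the function $t\mapsto e^{-irt}f(t)$ belongs to $ANP(I:X)$ for every $r\in\mathbb{R}\setminus\Lambda$. -/

import Mathlib

namespace AlmostAnti

open Set Filter Topology MeasureTheory

/-! Functions `f : I → X`, where `I` is `ℝ` or `[0, ∞)`, are represented by total functions
`ℝ → X` of which only the values on `I` are ever used. -/

/-- `S` is relatively dense in `I`: for some `l > 0`, every subinterval of `I` of length `l`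
meets `S`. -/
def RelativelyDenseIn (S I : Set ℝ) : Prop :=
  ∃ l : ℝ, 0 < l ∧ ∀ a : ℝ, Icc a (a + l) ⊆ I → (S ∩ Icc a (a + l)).Nonempty

section

variable {X : Type*} [NormedAddCommGroup X]

/-- The set of `ε`-periods of `f` on `I`: nonzero `τ ∈ I` with `‖f (t + τ) - f t‖ ≤ ε` on `I`.
For `I = [0, ∞)` the condition `τ ∈ I`, `τ ≠ 0` says `τ > 0`; on the whole line,
periods of both signs are admitted, as relative density in `ℝ` requires. -/
def periods (I : Set ℝ) (f : ℝ → X) (ε : ℝ) : Set ℝ :=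
  {τ | τ ∈ I ∧ τ ≠ 0 ∧ ∀ t ∈ I, ‖f (t + τ) - f t‖ ≤ ε}

/-- The set of `ε`-antiperiods of `f` on `I`. -/
def antiperiods (I : Set ℝ) (f : ℝ → X) (ε : ℝ) : Set ℝ :=
  {τ | τ ∈ I ∧ τ ≠ 0 ∧ ∀ t ∈ I, ‖f (t + τ) + f t‖ ≤ ε}

/-- `f` is (continuous and) almost periodic on `I`, in the sense of Bohr. -/
def IsAlmostPeriodic (I : Set ℝ) (f : ℝ → X) : Prop :=
  ContinuousOn f I ∧ ∀ ε : ℝ, 0 < ε → RelativelyDenseIn (periods I f ε) I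

/-- `f` is (continuous and) almost anti-periodic on `I`. -/
def IsAlmostAntiPeriodic (I : Set ℝ) (f : ℝ → X) : Prop :=
  ContinuousOn f I ∧ ∀ ε : ℝ, 0 < ε → RelativelyDenseIn (antiperiods I f ε) I

end

section

variable {X : Type*} [NormedAddCommGroup X] [NormedSpace ℂ X]

/-- `p` is the value `P_r(f) = lim_{t → ∞} (1 / t) ∫₀ᵗ e^{-irs} f(s) ds` of the Bohr transform
of `f` at `r`. -/
def IsBohrTransform (f : ℝ → X) (r : ℝ) (p : X) : Prop :=
  Tendsto (fun t : ℝ => (1 / t) • ∫ s in (0 : ℝ)..t, Complex.exp (-(Complex.I * r * s)) • f s)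
    atTop (𝓝 p)

/-- The Bohr spectrum `σ(f) = {r : P_r(f) ≠ 0}`. -/
def bohrSpectrum (f : ℝ → X) : Set ℝ :=
  {r | ∃ p : X, IsBohrTransform f r p ∧ p ≠ 0}

variable (X)

/-- `AP_Λ(I : X)`: the almost periodic functions on `I` with spectrum contained in `Λ`. -/
def APSpec (I Λ : Set ℝ) : Set (ℝ → X) :=
  {f | IsAlmostPeriodic I f ∧ bohrSpectrum f ⊆ Λ}

/-- `ANP₀(I : X)`: the linear span of the almost anti-periodic functions. -/
def ANP₀ (I : Set ℝ) : Submodule ℂ (ℝ → X) :=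
  Submodule.span ℂ {g | IsAlmostAntiPeriodic I g}

/-- `ANP(I : X)`: the closure of `ANP₀(I : X)` in `AP(I : X)` for the sup-norm over `I`. -/
def ANP (I : Set ℝ) : Set (ℝ → X) :=
  {f | IsAlmostPeriodic I f ∧ ∀ ε : ℝ, 0 < ε → ∃ g ∈ ANP₀ X I, ∀ t ∈ I, ‖f t - g t‖ ≤ ε}

end

end AlmostAnti

/-! Since `P_r(f)` is the mean value of `e^{-irs} f(s)`, and this modulated function is again almost
periodic, everything reduces to one claim: an almost periodic function lies in `ANP` exactly when
its mean value is zero.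

One direction is soft (`eq_zero_of_mem_ANP`). Means are translation invariant, so an almost
anti-periodic function with mean `p` satisfies `p = -p`; mean zero then passes to linear
combinations and uniform limits.

The converse (`mem_ANP_of_hasMean_zero`) is a form of Bohr's approximation theorem. The mean over
`s` of `Q(s) f(t + s)`, for a trigonometric polynomial `Q`, is a trigonometric polynomial in `t`
with coefficients in `X`. Its constant term vanishes because `f` has mean zero, and each `e^{irt} x`
with `r ≠ 0` is anti-periodic. It remains to choose `Q ≥ 0` so that this average, divided by the
mean of `Q`, is uniformly close to `f`. By Bogolyubov's lemma the `ε`-periods of `f` contain a Bohr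
set (`exists_bohr_set`), and `exists_kernel` builds `Q` concentrated there as a product of high even
powers of cosines. -/

namespace AlmostAnti

open Set Filter Topology MeasureTheory

/-! ### Bogolyubov's lemma, modulo `M` and for syndetic sets of naturals. -/

section Bogolyubov

/-- The (unnormalised) discrete Fourier transform of the indicator function of `A`. -/
noncomputable def indicatorDFT {M : ℕ} [NeZero M] (A : Finset (ZMod M)) (r : ZMod M) : ℂ :=
  ∑ a ∈ A, ZMod.stdAddChar (r * a)

variable {M : ℕ} [NeZero M] (A : Finset (ZMod M))

lemma sq_norm_indicatorDFT (r : ZMod M) :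
    ((‖indicatorDFT A r‖ ^ 2 : ℝ) : ℂ)
      = ∑ p ∈ A ×ˢ A, ZMod.stdAddChar (r * (p.1 - p.2)) := by
  push_cast
  rw [← Complex.mul_conj', indicatorDFT, map_sum, Finset.sum_mul_sum, Finset.sum_product]
  refine Finset.sum_congr rfl fun a _ => Finset.sum_congr rfl fun b _ => ?_
  rw [← AddChar.map_neg_eq_conj, ← AddChar.map_add_eq_mul]
  congr 1
  ring

/-- Parseval: by orthogonality of characters only the diagonal pairs survive. -/
lemma sum_sq_norm_indicatorDFT : ∑ r, ‖indicatorDFT A r‖ ^ 2 = M * A.card := by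
  have h : ((∑ r, ‖indicatorDFT A r‖ ^ 2 : ℝ) : ℂ) = ((M * A.card : ℝ) : ℂ) := by
    rw [Complex.ofReal_sum]
    simp_rw [sq_norm_indicatorDFT]
    rw [Finset.sum_comm]
    simp_rw [AddChar.sum_mulShift _ (ZMod.isPrimitive_stdAddChar M), ZMod.card, sub_eq_zero]
    rw [Finset.sum_product]
    simp [mul_comm]
  exact_mod_cast h

/-- By orthogonality the sum is `M` times the number of ways to write `n` as `a + b - c - d` with
all four terms in `A`. -/
lemma sum_pow_four_norm_indicatorDFT (n : ZMod M)
    (hn : ∀ a ∈ A, ∀ b ∈ A, ∀ c ∈ A, ∀ d ∈ A, n + c + d ≠ a + b) :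
    ∑ r, ‖indicatorDFT A r‖ ^ 4 * (ZMod.stdAddChar (r * n)).re = 0 := by
  have h : ∑ r, ((‖indicatorDFT A r‖ ^ 4 : ℝ) : ℂ) * ZMod.stdAddChar (r * (-n)) = 0 := by
    have h1 : ∀ r, ((‖indicatorDFT A r‖ ^ 4 : ℝ) : ℂ) * ZMod.stdAddChar (r * (-n))
        = ∑ p ∈ A ×ˢ A, ∑ q ∈ A ×ˢ A,
          ZMod.stdAddChar (r * (p.1 - p.2 + (q.1 - q.2) - n)) := by
      intro r
      rw [show ‖indicatorDFT A r‖ ^ 4 = ‖indicatorDFT A r‖ ^ 2 * ‖indicatorDFT A r‖ ^ 2 by ring,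
        Complex.ofReal_mul, sq_norm_indicatorDFT, Finset.sum_mul_sum, Finset.sum_mul]
      refine Finset.sum_congr rfl fun p _ => ?_
      rw [Finset.sum_mul]
      refine Finset.sum_congr rfl fun q _ => ?_
      rw [← AddChar.map_add_eq_mul, ← AddChar.map_add_eq_mul]
      congr 1
      ring
    simp_rw [h1]
    rw [Finset.sum_comm]
    refine Finset.sum_eq_zero fun p hp => ?_
    rw [Finset.sum_comm]
    refine Finset.sum_eq_zero fun q hq => ?_
    rw [AddChar.sum_mulShift _ (ZMod.isPrimitive_stdAddChar M), if_neg, Nat.cast_zero]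
    rw [Finset.mem_product] at hp hq
    intro h0
    exact hn _ hp.1 _ hq.1 _ hp.2 _ hq.2 (by linear_combination -h0)
  have h2 := congrArg Complex.re h
  rw [Complex.re_sum, Complex.zero_re] at h2
  rw [← h2]
  refine Finset.sum_congr rfl fun r _ => ?_
  rw [Complex.re_ofReal_mul, mul_neg, AddChar.map_neg_eq_conj, Complex.conj_re]

/-- Bogolyubov's lemma in `ℤ / M`: the large spectrum `R` of `A` is small, and `2A - 2A` contains
the Bohr set defined by `R`. -/
lemma exists_large_spectrum (hA : A.Nonempty) :
    ∃ R : Finset (ZMod M), R.card * (A.card : ℝ) ^ 2 ≤ 2 * (M : ℝ) ^ 2 ∧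
      ∀ n : ZMod M, (∀ r ∈ R, 0 ≤ (ZMod.stdAddChar (r * n)).re) →
        ∃ a ∈ A, ∃ b ∈ A, ∃ c ∈ A, ∃ d ∈ A, n + c + d = a + b := by
  classical
  have hM : (0 : ℝ) < M := by exact_mod_cast Nat.pos_of_ne_zero (NeZero.ne M)
  have hc : (0 : ℝ) < A.card := by exact_mod_cast hA.card_pos
  set K : ℝ := (A.card : ℝ) with hK
  -- With this threshold the frequencies outside `R` contribute at least `-θ * (M * K) = -K ^ 4 /
  -- 2`, which cannot cancel the term `K ^ 4` at `r = 0`.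
  set θ : ℝ := K ^ 3 / (2 * M) with hθ
  have hθ0 : 0 < θ := by positivity
  refine ⟨Finset.univ.filter fun r => θ ≤ ‖indicatorDFT A r‖ ^ 2, ?_, ?_⟩
  · have h1 : (Finset.univ.filter fun r => θ ≤ ‖indicatorDFT A r‖ ^ 2).card * θ ≤ M * K := by
      rw [← sum_sq_norm_indicatorDFT, ← nsmul_eq_mul]
      refine (Finset.card_nsmul_le_sum _ (fun r => ‖indicatorDFT A r‖ ^ 2) _ ?_).trans ?_
      · intro r hr
        exact (Finset.mem_filter.1 hr).2
      · exact Finset.sum_le_sum_of_subset_of_nonneg (Finset.subset_univ _)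
          fun _ _ _ => by positivity
    rw [hθ, mul_div_assoc', div_le_iff₀ (by positivity)] at h1
    refine le_of_mul_le_mul_right ?_ hc
    nlinarith [h1]
  · intro n hn
    by_contra! hcon
    have h0 := sum_pow_four_norm_indicatorDFT A n hcon
    have hz : ‖indicatorDFT A 0‖ ^ 4 = K ^ 4 := by
      simp [indicatorDFT, hK]
    have hle : ∀ r ∈ Finset.univ.erase (0 : ZMod M), -(θ * ‖indicatorDFT A r‖ ^ 2) ≤
        ‖indicatorDFT A r‖ ^ 4 * (ZMod.stdAddChar (r * n)).re := by
      intro r _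
      by_cases hr : θ ≤ ‖indicatorDFT A r‖ ^ 2
      · have := hn r (by simpa using hr)
        have h1 : 0 ≤ ‖indicatorDFT A r‖ ^ 4 * (ZMod.stdAddChar (r * n)).re := by positivity
        have h2 : 0 ≤ θ * ‖indicatorDFT A r‖ ^ 2 := by positivity
        linarith
      · have h1 : -1 ≤ (ZMod.stdAddChar (r * n)).re := by
          have := Complex.abs_re_le_norm (ZMod.stdAddChar (r * n))
          rw [AddChar.norm_apply] at this
          exact (abs_le.1 this).1
        push Not at hr
        have h2 : 0 ≤ ‖indicatorDFT A r‖ ^ 2 := by positivity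
        have h3 : 0 ≤ ‖indicatorDFT A r‖ ^ 4 := by positivity
        nlinarith [mul_le_mul_of_nonneg_right hr.le h2]
    have h3 := Finset.sum_le_sum hle
    rw [← Finset.add_sum_erase _ _ (Finset.mem_univ (0 : ZMod M)), hz] at h0
    simp only [zero_mul, AddChar.map_zero_eq_one, Complex.one_re, mul_one] at h0
    rw [Finset.sum_neg_distrib, ← Finset.mul_sum] at h3
    have h4 : ∑ r ∈ Finset.univ.erase (0 : ZMod M), ‖indicatorDFT A r‖ ^ 2 ≤ M * K := by
      rw [← sum_sq_norm_indicatorDFT]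
      exact Finset.sum_le_sum_of_subset_of_nonneg (Finset.subset_univ _)
          fun _ _ _ => by positivity
    have h5 := mul_le_mul_of_nonneg_left h4 hθ0.le
    have h6 : θ * (M * K) = K ^ 4 / 2 := by
      rw [hθ]
      field_simp
    have : 0 < K ^ 4 := by positivity
    linarith

end Bogolyubov

lemma exists_fin_cover {α : Type*} [Inhabited α] (R : Finset α) {k : ℕ} (h : R.card ≤ k) :
    ∃ z : Fin k → α, ∀ c ∈ R, ∃ j, z j = c := by
  refine ⟨fun j => if hj : (j : ℕ) < R.card then R.equivFin.symm ⟨j, hj⟩ else default, ?_⟩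
  intro c hc
  refine ⟨⟨R.equivFin ⟨c, hc⟩, (R.equivFin ⟨c, hc⟩).2.trans_le h⟩, ?_⟩
  simp

lemma re_nonneg_of_norm_sub_one_lt {z : ℂ} (h : ‖z - 1‖ < 1) : 0 ≤ z.re := by
  have h1 := (Complex.abs_re_le_norm (z - 1)).trans_lt h
  rw [Complex.sub_re, Complex.one_re] at h1
  linarith [(abs_lt.1 h1).1]

/-- The finite form of Bogolyubov's lemma, with a bound on the number of frequencies that does
not depend on `N`. -/
lemma exists_frequencies_of_syndetic_of_lt (E : Set ℕ) {L : ℕ}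
    (hE : ∀ a : ℕ, ∃ n ∈ E, a ≤ n ∧ n ≤ a + L) (N : ℕ) :
    ∃ z : Fin (32 * (L + 1) ^ 2) → Circle, ∀ n : ℕ, n < N → (∀ j, ‖(z j : ℂ) ^ n - 1‖ < 1) →
      ∃ a ∈ E, ∃ b ∈ E, ∃ c ∈ E, ∃ d ∈ E, n + c + d = a + b := by
  classical
  choose e he hae heL using hE
  obtain rfl | hN := Nat.eq_zero_or_pos N
  · exact ⟨fun _ => 1, fun n hn => absurd hn (Nat.not_lt_zero n)⟩
  -- One element of `E` is taken from each of the `N` disjoint windows of length `L + 1`. As `n`,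
  -- `c`, `d` are below `N * (L + 1)`, both sides of `n + c + d = a + b` stay below `M`, so the
  -- congruence is an equality. The density `1 / (4 * (L + 1))` of `A` gives the bound `32 * (L + 1)
  -- ^ 2`.
  set M : ℕ := 4 * (N * (L + 1)) with hM
  have hM0 : 0 < M := by positivity
  have : NeZero M := ⟨hM0.ne'⟩
  have hlt : ∀ i ∈ Finset.range N, e (i * (L + 1)) < N * (L + 1) := by
    intro i hi
    have h1 : i + 1 ≤ N := Finset.mem_range.1 hi
    have := heL (i * (L + 1))
    nlinarith [Nat.mul_le_mul_right (L + 1) h1]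
  have hmono : StrictMono fun i => e (i * (L + 1)) := by
    refine strictMono_nat_of_lt_succ fun i => ?_
    have h1 := heL (i * (L + 1))
    have h2 := hae ((i + 1) * (L + 1))
    nlinarith
  set A : Finset (ZMod M) := (Finset.range N).image fun i => (e (i * (L + 1)) : ZMod M) with hA
  have hcard : A.card = N := by
    rw [hA, Finset.card_image_of_injOn, Finset.card_range]
    intro i hi j hj hij
    have h1 := (ZMod.natCast_eq_natCast_iff _ _ _).1 hij
    have h2 := hlt i hi
    have h3 := hlt j hj
    exact hmono.injective (Nat.ModEq.eq_of_lt_of_lt h1 (by omega) (by omega))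
  have hne : A.Nonempty := by
    rw [← Finset.card_pos, hcard]
    exact hN
  obtain ⟨R, hR, hRn⟩ := exists_large_spectrum A hne
  have hRk : (R.image ZMod.toCircle).card ≤ 32 * (L + 1) ^ 2 := by
    refine Finset.card_image_le.trans ?_
    have hMR : (M : ℝ) = 4 * (N * (L + 1)) := by
      rw [hM]
      push_cast
      ring
    rw [hcard, hMR] at hR
    have hN' : (0 : ℝ) < (N : ℝ) ^ 2 := by positivity
    have h1 : (R.card : ℝ) * (N : ℝ) ^ 2 ≤ (32 * (L + 1) ^ 2 : ℝ) * (N : ℝ) ^ 2 := by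
      linarith
    have h2 := le_of_mul_le_mul_right h1 hN'
    have h3 : R.card ≤ 32 * (L + 1) ^ 2 := by exact_mod_cast h2
    exact h3
  have : Inhabited Circle := ⟨1⟩
  obtain ⟨z, hz⟩ := exists_fin_cover _ hRk
  refine ⟨z, fun n hn h => ?_⟩
  obtain ⟨a, ha, b, hb, c, hc, d, hd, habcd⟩ := hRn n fun r hr => by
    obtain ⟨j, hj⟩ := hz _ (Finset.mem_image_of_mem _ hr)
    refine re_nonneg_of_norm_sub_one_lt ?_
    have h1 := h j
    rwa [hj, ← ZMod.stdAddChar_apply, ← AddChar.map_nsmul_eq_pow, nsmul_eq_mul, mul_comm] at h1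
  simp only [hA, Finset.mem_image] at ha hb hc hd
  obtain ⟨a, ha, rfl⟩ := ha
  obtain ⟨b, hb, rfl⟩ := hb
  obtain ⟨c, hc, rfl⟩ := hc
  obtain ⟨d, hd, rfl⟩ := hd
  refine ⟨_, he (a * (L + 1)), _, he (b * (L + 1)), _, he (c * (L + 1)), _, he (d * (L + 1)), ?_⟩
  have h1 := hlt _ ha
  have h2 := hlt _ hb
  have h3 := hlt _ hc
  have h4 := hlt _ hd
  have h5 : N ≤ N * (L + 1) := Nat.le_mul_of_pos_right N (by omega)
  refine Nat.ModEq.eq_of_lt_of_lt (m := M) ?_ (by omega) (by omega)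
  rw [← ZMod.natCast_eq_natCast_iff]
  push_cast
  exact habcd

/-- **Bogolyubov's lemma**: if `E` is a syndetic set of natural numbers, `E + E - E - E` contains
a Bohr set. -/
lemma exists_frequencies_of_syndetic (E : Set ℕ) {L : ℕ}
    (hE : ∀ a : ℕ, ∃ n ∈ E, a ≤ n ∧ n ≤ a + L) :
    ∃ (k : ℕ) (z : Fin k → Circle), ∀ n : ℕ, (∀ j, ‖(z j : ℂ) ^ n - 1‖ < 1) →
      ∃ a ∈ E, ∃ b ∈ E, ∃ c ∈ E, ∃ d ∈ E, n + c + d = a + b := by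
  choose z hz using exists_frequencies_of_syndetic_of_lt E hE
  -- The number of frequencies does not depend on `N`, so compactness of the torus gives limit
  -- frequencies. For fixed `n` the strict inequalities at `w` persist at `z (φ N)` for large `N`.
  obtain ⟨w, φ, hφ, hw⟩ := CompactSpace.tendsto_subseq z
  refine ⟨_, w, fun n hn => ?_⟩
  have h1 : ∀ j, ∀ᶠ N in atTop, ‖(z (φ N) j : ℂ) ^ n - 1‖ < 1 := by
    intro j
    have h2 : Tendsto (fun N => ‖(z (φ N) j : ℂ) ^ n - 1‖) atTop (𝓝 ‖(w j : ℂ) ^ n - 1‖) := by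
      have h3 : Tendsto (fun N => z (φ N) j) atTop (𝓝 (w j)) := (tendsto_pi_nhds.1 hw) j
      exact (((continuous_subtype_val.tendsto (w j)).comp h3).pow n |>.sub_const 1).norm
    exact h2.eventually_lt_const (hn j)
  obtain ⟨N, hN1, hN2⟩ := ((eventually_all.2 h1).and (eventually_gt_atTop n)).exists
  exact hz (φ N) n (hN2.trans_le hφ.le_apply) hN1

/-! ### Characters of the real line and their Bohr sets. -/

section Characters

/-- The character `s ↦ e^{irs}` of the real line. -/
noncomputable def expChar (r s : ℝ) : ℂ := Complex.exp (Complex.I * r * s)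

lemma expChar_eq (r s : ℝ) : expChar r s = Complex.exp (Complex.I * ((r * s : ℝ) : ℂ)) := by
  rw [expChar, Complex.ofReal_mul, mul_assoc]

lemma exp_neg_eq_expChar (r s : ℝ) : Complex.exp (-(Complex.I * r * s)) = expChar (-r) s := by
  rw [expChar]
  congr 1
  push_cast
  ring

lemma norm_expChar (r s : ℝ) : ‖expChar r s‖ = 1 := by
  rw [expChar_eq, Complex.norm_exp_I_mul_ofReal]

lemma expChar_add_right (r s t : ℝ) : expChar r (s + t) = expChar r s * expChar r t := by
  rw [expChar, expChar, expChar, ← Complex.exp_add]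
  congr 1
  push_cast
  ring

lemma expChar_add_left (r s t : ℝ) : expChar (r + s) t = expChar r t * expChar s t := by
  rw [expChar, expChar, expChar, ← Complex.exp_add]
  congr 1
  push_cast
  ring

lemma expChar_zero_left (t : ℝ) : expChar 0 t = 1 := by simp [expChar]

lemma expChar_zero_right (r : ℝ) : expChar r 0 = 1 := by simp [expChar]

lemma continuous_expChar (r : ℝ) : Continuous (expChar r) := by
  unfold expChar
  fun_prop

lemma norm_expChar_sub (r s t : ℝ) : ‖expChar r s - expChar r t‖ = ‖expChar r (s - t) - 1‖ := by
  have h : expChar r s - expChar r t = (expChar r (s - t) - 1) * expChar r t := by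
    rw [sub_mul, ← expChar_add_right, sub_add_cancel, one_mul]
  rw [h, norm_mul, norm_expChar, mul_one]

lemma norm_expChar_sub_one_le (r s : ℝ) : ‖expChar r s - 1‖ ≤ |r * s| := by
  rw [expChar_eq]
  exact Real.norm_exp_I_mul_ofReal_sub_one_le

lemma norm_expChar_neg_sub_one (r s : ℝ) : ‖expChar r (-s) - 1‖ = ‖expChar r s - 1‖ := by
  rw [← zero_sub, ← norm_expChar_sub, expChar_zero_right, norm_sub_rev]

/-- Jordan's inequality for the sine. It lets a Bohr condition at frequency `2π / δ` force closeness
to a multiple of `δ`. -/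
lemma four_mul_abs_sub_round_le (x : ℝ) : 4 * |x - round x| ≤ ‖expChar (2 * Real.pi) x - 1‖ := by
  rw [expChar_eq, Complex.norm_exp_I_mul_ofReal_sub_one, norm_mul, Real.norm_eq_abs, Real.norm_eq_abs,
    show 2 * Real.pi * x / 2 = x * Real.pi by ring]
  have h1 : |Real.sin (x * Real.pi)| = |Real.sin ((x - round x) * Real.pi)| := by
    rw [sub_mul, Real.sin_sub_int_mul_pi, abs_mul, abs_zpow, abs_neg, abs_one, one_zpow, one_mul]
  have h2 : |(x - round x) * Real.pi| = |x - round x| * Real.pi := by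
    rw [abs_mul, abs_of_pos Real.pi_pos]
  have h3 := Real.mul_abs_le_abs_sin (x := (x - round x) * Real.pi) (by
    rw [h2]
    nlinarith [abs_sub_round x, Real.pi_pos])
  rw [h2] at h3
  have h4 : 2 / Real.pi * (|x - round x| * Real.pi) = 2 * |x - round x| := by
    field_simp
  rw [h1, abs_two]
  linarith

/-- Bohr sets are relatively dense. -/
lemma exists_mem_Icc_norm_expChar_sub_one_lt (S : Finset ℝ) {η : ℝ} (hη : 0 < η) :
    ∃ l : ℝ, 0 < l ∧ ∀ a : ℝ, ∃ s ∈ Icc a (a + l), s ≠ 0 ∧ ∀ r ∈ S, ‖expChar r s - 1‖ < η := by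
  set Φ : ℝ → (S → ℂ) := fun s r => expChar r s with hΦ
  -- Pigeonhole: finitely many points of the curve `Φ` form an `η`-net, and subtracting the time of
  -- a nearby net point from `b` moves `b` boundedly into the Bohr set.
  have hb : TotallyBounded (range Φ) := by
    refine (isCompact_closedBall (0 : S → ℂ) 1).totallyBounded.subset ?_
    rintro _ ⟨s, rfl⟩
    rw [mem_closedBall_zero_iff]
    refine (pi_norm_le_iff_of_nonneg zero_le_one).2 fun r => ?_
    exact (norm_expChar _ _).le
  obtain ⟨T, hT, hTf, hcov⟩ := Metric.finite_approx_of_totallyBounded hb η hη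
  choose! p hp using fun y (hy : y ∈ T) => hT hy
  obtain ⟨l, hl⟩ : ∃ l, ∀ y ∈ T, |p y| ≤ l := by
    obtain ⟨l, hl⟩ := (hTf.image fun y => |p y|).bddAbove
    exact ⟨l, fun y hy => hl (mem_image_of_mem _ hy)⟩
  have key : ∀ b : ℝ, ∃ s, |s - b| ≤ |l| ∧ ∀ r ∈ S, ‖expChar r s - 1‖ < η := by
    intro b
    obtain ⟨y, hy, hby⟩ := mem_iUnion₂.1 (hcov (mem_range_self b))
    refine ⟨b - p y, ?_, fun r hr => ?_⟩
    · rw [sub_right_comm, sub_self, zero_sub, abs_neg]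
      exact (hl y hy).trans (le_abs_self l)
    · rw [← norm_expChar_sub]
      rw [Metric.mem_ball, ← hp y hy, dist_eq_norm] at hby
      exact (norm_le_pi_norm (Φ b - Φ (p y)) ⟨r, hr⟩).trans_lt hby
  refine ⟨4 * |l| + 1, by positivity, fun a => ?_⟩
  obtain ⟨s, hs, hsS⟩ := key (a + |l|)
  rw [abs_le] at hs
  -- If the point found is `0`, a second window lying beyond `a + 2 * |l|` supplies a positive one.
  by_cases hs0 : s = 0
  · obtain ⟨s', hs', hsS'⟩ := key (a + 3 * |l| + 1)
    rw [abs_le] at hs'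
    refine ⟨s', ⟨by linarith [abs_nonneg l], by linarith⟩, fun h => ?_, hsS'⟩
    linarith
  · exact ⟨s, ⟨by linarith, by linarith [abs_nonneg l]⟩, hs0, hsS⟩

end Characters

section Domain

variable {I : Set ℝ}

lemma mem_of_nonneg (hI : I = univ ∨ I = Ici (0 : ℝ)) {t : ℝ} (ht : 0 ≤ t) : t ∈ I := by
  rcases hI with rfl | rfl
  · trivial
  · exact ht

lemma add_mem_domain (hI : I = univ ∨ I = Ici (0 : ℝ)) {s t : ℝ} (hs : s ∈ I) (ht : t ∈ I) :
    s + t ∈ I := by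
  rcases hI with rfl | rfl
  · trivial
  · exact add_nonneg (mem_Ici.1 hs) ht

end Domain

/-! ### Almost periodic functions: boundedness, uniform continuity, periods. -/

section Basic

variable {X : Type*} [NormedAddCommGroup X] {I : Set ℝ} {f : ℝ → X}

/-- Carries compactness of `[0, l]` over to all of `I`. -/
lemma IsAlmostPeriodic.exists_sub_mem_Icc (hf : IsAlmostPeriodic I f)
    (hI : I = univ ∨ I = Ici (0 : ℝ)) {ε : ℝ} (hε : 0 < ε) :
    ∃ l : ℝ, 0 < l ∧ ∀ s ∈ I, ∃ τ ∈ I, s - τ ∈ Icc 0 l ∧ ∀ t ∈ I, ‖f (t + τ) - f t‖ ≤ ε := by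
  obtain ⟨l, hl, h⟩ := hf.2 ε hε
  refine ⟨l, hl, fun s hs => ?_⟩
  by_cases hsub : Icc (s - l) (s - l + l) ⊆ I
  · obtain ⟨τ, ⟨hτ, -, hp⟩, h1, h2⟩ := h _ hsub
    exact ⟨τ, hτ, ⟨by linarith, by linarith⟩, hp⟩
  · rcases hI with rfl | rfl
    · exact absurd (subset_univ _) hsub
    · have hs0 : 0 ≤ s := hs
      have hsl : s < l := by
        by_contra! hc
        exact hsub fun x hx => mem_Ici.2 (by linarith [hx.1])
      -- Near the end of the half-line no translation is needed; the conclusion admits `τ = 0` for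
      -- this case.
      refine ⟨0, mem_Ici.2 le_rfl, ⟨by linarith, by linarith⟩, fun t _ => ?_⟩
      simpa using hε.le

lemma IsAlmostPeriodic.exists_bound (hf : IsAlmostPeriodic I f)
    (hI : I = univ ∨ I = Ici (0 : ℝ)) : ∃ C : ℝ, ∀ t ∈ I, ‖f t‖ ≤ C := by
  obtain ⟨l, hl, h⟩ := hf.exists_sub_mem_Icc hI one_pos
  obtain ⟨C, hC⟩ := (isCompact_Icc (a := (0 : ℝ)) (b := l)).exists_bound_of_continuousOn
    (hf.1.mono fun x hx => mem_of_nonneg hI hx.1)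
  refine ⟨C + 1, fun t ht => ?_⟩
  obtain ⟨τ, -, h1, h2⟩ := h t ht
  have h3 := h2 (t - τ) (mem_of_nonneg hI h1.1)
  rw [sub_add_cancel] at h3
  have h4 := norm_le_norm_add_norm_sub' (f t) (f (t - τ))
  linarith [hC _ h1]

lemma IsAlmostPeriodic.uniform_continuity (hf : IsAlmostPeriodic I f)
    (hI : I = univ ∨ I = Ici (0 : ℝ)) {ε : ℝ} (hε : 0 < ε) :
    ∃ δ : ℝ, 0 < δ ∧ ∀ s ∈ I, ∀ t ∈ I, |s - t| < δ → ‖f s - f t‖ ≤ ε := by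
  obtain ⟨l, hl, h⟩ := hf.exists_sub_mem_Icc hI (show 0 < ε / 3 by positivity)
  have hu := (isCompact_Icc (a := (0 : ℝ)) (b := l + 1)).uniformContinuousOn_of_continuous
    (hf.1.mono fun x hx => mem_of_nonneg hI hx.1)
  obtain ⟨δ, hδ, hδu⟩ := Metric.uniformContinuousOn_iff.1 hu (ε / 3) (by positivity)
  have key : ∀ s ∈ I, ∀ t ∈ I, s ≤ t → |s - t| < min δ 1 → ‖f s - f t‖ ≤ ε := by
    intro s hs t ht hst hd
    obtain ⟨τ, -, h1, h2⟩ := h s hs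
    have hd' := abs_lt.1 (hd.trans_le (min_le_right _ _))
    have h0t : 0 ≤ t - τ := by linarith [h1.1]
    have h3 := h2 (s - τ) (mem_of_nonneg hI h1.1)
    have h4 := h2 (t - τ) (mem_of_nonneg hI h0t)
    have h5 := hδu (s - τ) ⟨h1.1, by linarith [h1.2]⟩ (t - τ) ⟨h0t, by linarith [h1.2]⟩ (by
      rw [Real.dist_eq, sub_sub_sub_cancel_right]
      exact hd.trans_le (min_le_left _ _))
    rw [sub_add_cancel] at h3 h4
    rw [dist_eq_norm] at h5
    have h6 : f s - f t = (f s - f (s - τ)) + (f (s - τ) - f (t - τ)) - (f t - f (t - τ)) := by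
      abel
    rw [h6]
    exact (norm_sub_le _ _).trans (by linarith [norm_add_le (f s - f (s - τ)) (f (s - τ) - f (t - τ))])
  refine ⟨min δ 1, by positivity, fun s hs t ht hd => ?_⟩
  rcases le_total s t with hst | hst
  · exact key s hs t ht hst hd
  · rw [norm_sub_rev]
    exact key t ht s hs hst (by rwa [abs_sub_comm])

/-- Rounding a period down to a multiple of `δ` costs one more `ε`; this produces a syndetic set of
naturals for Bogolyubov's lemma. -/
lemma IsAlmostPeriodic.exists_natMul_period (hf : IsAlmostPeriodic I f)
    (hI : I = univ ∨ I = Ici (0 : ℝ)) {ε δ : ℝ} (hε : 0 < ε) (hδ : 0 < δ)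
    (hfδ : ∀ s ∈ I, ∀ t ∈ I, |s - t| < δ → ‖f s - f t‖ ≤ ε) :
    ∃ L : ℕ, ∀ a : ℕ, ∃ n ∈ {n : ℕ | ∀ t ∈ I, ‖f (t + n * δ) - f t‖ ≤ 2 * ε},
      a ≤ n ∧ n ≤ a + L := by
  obtain ⟨l, hl, h⟩ := hf.2 ε hε
  refine ⟨⌈l / δ⌉₊, fun a => ?_⟩
  have ha : 0 ≤ a * δ := by positivity
  obtain ⟨τ, ⟨hτI, -, hp⟩, h1, h2⟩ := h (a * δ) fun x hx => mem_of_nonneg hI (ha.trans hx.1)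
  have hτ0 : 0 ≤ τ := ha.trans h1
  have hn1 : (⌊τ / δ⌋₊ : ℝ) * δ ≤ τ := (le_div_iff₀ hδ).1 (Nat.floor_le (by positivity))
  have hn2 : τ < (⌊τ / δ⌋₊ + 1 : ℝ) * δ := (div_lt_iff₀ hδ).1 (Nat.lt_floor_add_one _)
  refine ⟨⌊τ / δ⌋₊, fun t ht => ?_, Nat.le_floor ((le_div_iff₀ hδ).2 h1), ?_⟩
  · have h3 := hp t ht
    have h4 := hfδ (t + ⌊τ / δ⌋₊ * δ) (add_mem_domain hI ht (mem_of_nonneg hI (by positivity)))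
      (t + τ) (add_mem_domain hI ht hτI) (by
        rw [add_sub_add_left_eq_sub, abs_lt]
        constructor <;> linarith)
    have h5 := norm_sub_le_norm_sub_add_norm_sub (f (t + ⌊τ / δ⌋₊ * δ)) (f (t + τ)) (f t)
    linarith
  · have h3 : (⌊τ / δ⌋₊ : ℝ) ≤ a + ⌈l / δ⌉₊ := by
      refine (Nat.floor_le (by positivity)).trans ?_
      rw [div_le_iff₀ hδ]
      have := (div_le_iff₀ hδ).1 (Nat.le_ceil (l / δ))
      linarith
    exact_mod_cast h3

lemma IsAlmostPeriodic.exists_bohr_set_of_nonneg (hf : IsAlmostPeriodic I f)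
    (hI : I = univ ∨ I = Ici (0 : ℝ)) {ε : ℝ} (hε : 0 < ε) :
    ∃ S : Finset ℝ, ∀ s : ℝ, 0 ≤ s → (∀ r ∈ S, ‖expChar r s - 1‖ < 1 / 4) →
      ∀ t ∈ I, ‖f (t + s) - f t‖ ≤ ε := by
  classical
  -- The final chain uses four discrete periods, each with error `2 * (ε / 9)`, and one rounding
  -- error `ε / 9`.
  obtain ⟨δ, hδ, hfδ⟩ := hf.uniform_continuity hI (show 0 < ε / 9 by positivity)
  obtain ⟨L, hL⟩ := hf.exists_natMul_period hI (show 0 < ε / 9 by positivity) hδ hfδ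
  obtain ⟨k, z, hz⟩ := exists_frequencies_of_syndetic _ hL
  -- The first frequency puts `x = s / δ` within `1 / 16` of an integer `n`. The others give `‖z j ^
  -- n - 1‖ < 1 / 4 + 1 / 4`, since replacing `x` by `n` costs at most `π / 16 ≤ 1 / 4`.
  refine ⟨insert (2 * Real.pi / δ) (Finset.univ.image fun j => Complex.arg (z j) / δ),
    fun s hs hS t ht => ?_⟩
  obtain ⟨x, rfl⟩ : ∃ x, s = x * δ := ⟨s / δ, by field_simp⟩
  have hx : 0 ≤ x := nonneg_of_mul_nonneg_left hs hδ
  have hscale : ∀ r : ℝ, expChar (r / δ) (x * δ) = expChar r x := by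
    intro r
    rw [expChar_eq, expChar_eq]
    congr 3
    field_simp
  have hround := four_mul_abs_sub_round_le x
  have h1 := hS _ (Finset.mem_insert_self _ _)
  rw [hscale] at h1
  have hr0 : 0 ≤ round x := by
    rw [round_eq]
    exact Int.floor_nonneg.2 (by linarith)
  obtain ⟨n, hn⟩ := Int.eq_ofNat_of_zero_le hr0
  rw [hn, Int.cast_natCast] at hround
  have hxn : |x - n| < 1 / 16 := by linarith
  obtain ⟨a, ha, b, hb, c, hc, d, hd, habcd⟩ := hz n fun j => by
    have h2 := hS (Complex.arg (z j) / δ)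
      (Finset.mem_insert_of_mem (Finset.mem_image_of_mem _ (Finset.mem_univ j)))
    rw [hscale] at h2
    have h3 : (z j : ℂ) ^ n = expChar (Complex.arg (z j)) n := by
      have h4 := Complex.norm_mul_exp_arg_mul_I (z j : ℂ)
      rw [Circle.norm_coe, Complex.ofReal_one, one_mul] at h4
      rw [expChar]
      conv_lhs => rw [← h4, ← Complex.exp_nat_mul]
      congr 1
      push_cast
      ring
    have h5 : ‖expChar (Complex.arg (z j)) n - expChar (Complex.arg (z j)) x‖ ≤ 1 / 4 := by
      rw [norm_expChar_sub]
      refine (norm_expChar_sub_one_le _ _).trans ?_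
      rw [abs_mul, abs_sub_comm]
      have h6 := Complex.abs_arg_le_pi (z j : ℂ)
      have h7 := mul_le_mul (h6.trans Real.pi_le_four) hxn.le (abs_nonneg _) (by norm_num)
      linarith
    rw [h3]
    have h8 := norm_sub_le_norm_sub_add_norm_sub (expChar (Complex.arg (z j)) n)
      (expChar (Complex.arg (z j)) x) 1
    linarith
  have hnn : ∀ m : ℕ, (m : ℝ) * δ ∈ I := fun m => mem_of_nonneg hI (by positivity)
  have hu : t + n * δ ∈ I := add_mem_domain hI ht (hnn n)
  have e1 := hb t ht
  have e2 := ha (t + b * δ) (add_mem_domain hI ht (hnn b))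
  have e3 := hc (t + n * δ) hu
  have e4 := hd (t + n * δ + c * δ) (add_mem_domain hI hu (hnn c))
  have e5 : t + n * δ + c * δ + d * δ = t + b * δ + a * δ := by
    have : (n + c + d : ℝ) = a + b := by exact_mod_cast habcd
    linear_combination δ * this
  rw [e5, norm_sub_rev] at e4
  rw [norm_sub_rev] at e3
  have e6 := hfδ (t + x * δ) (add_mem_domain hI ht (mem_of_nonneg hI hs)) (t + n * δ) hu (by
    rw [add_sub_add_left_eq_sub, ← sub_mul, abs_mul, abs_of_pos hδ]
    nlinarith)
  have i1 := norm_sub_le_norm_sub_add_norm_sub (f (t + x * δ)) (f (t + n * δ)) (f t)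
  have i2 := norm_sub_le_norm_sub_add_norm_sub (f (t + n * δ)) (f (t + n * δ + c * δ)) (f t)
  have i3 := norm_sub_le_norm_sub_add_norm_sub (f (t + n * δ + c * δ)) (f (t + b * δ + a * δ)) (f t)
  have i4 := norm_sub_le_norm_sub_add_norm_sub (f (t + b * δ + a * δ)) (f (t + b * δ)) (f t)
  linarith

/-- The `ε`-periods of an almost periodic function contain a Bohr set. -/
lemma IsAlmostPeriodic.exists_bohr_set (hf : IsAlmostPeriodic I f)
    (hI : I = univ ∨ I = Ici (0 : ℝ)) {ε : ℝ} (hε : 0 < ε) :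
    ∃ S : Finset ℝ, ∀ s ∈ I, (∀ r ∈ S, ‖expChar r s - 1‖ < 1 / 4) →
      ∀ t ∈ I, ‖f (t + s) - f t‖ ≤ ε := by
  obtain ⟨S, hS⟩ := hf.exists_bohr_set_of_nonneg hI hε
  refine ⟨S, fun s hs hsS t ht => ?_⟩
  rcases le_total 0 s with h0 | h0
  · exact hS s h0 hsS t ht
  · have h1 := hS (-s) (neg_nonneg.2 h0) (fun r hr => by
      rw [norm_expChar_neg_sub_one]
      exact hsS r hr) (t + s) (add_mem_domain hI ht hs)
    rwa [add_neg_cancel_right, norm_sub_rev] at h1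

/-- Adding `r` to the frequencies for `f` gives common almost periods of `f` and of the character,
because Bohr sets are relatively dense. -/
lemma IsAlmostPeriodic.expChar_smul [NormedSpace ℂ X] (hf : IsAlmostPeriodic I f)
    (hI : I = univ ∨ I = Ici (0 : ℝ)) (r : ℝ) :
    IsAlmostPeriodic I fun t => expChar r t • f t := by
  classical
  refine ⟨(continuous_expChar r).continuousOn.smul hf.1, fun ε hε => ?_⟩
  obtain ⟨C, hC⟩ := hf.exists_bound hI
  obtain ⟨S, hS⟩ := hf.exists_bohr_set hI (show 0 < ε / 2 by positivity)
  set η : ℝ := ε / (2 * (|C| + 1)) with hη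
  have hη0 : 0 < η := by positivity
  obtain ⟨l, hl, h⟩ := exists_mem_Icc_norm_expChar_sub_one_lt (insert r S)
    (lt_min hη0 (show (0 : ℝ) < 1 / 4 by norm_num))
  refine ⟨l, hl, fun a ha => ?_⟩
  obtain ⟨s, hs, hs0, hsS⟩ := h a
  refine ⟨s, ⟨ha hs, hs0, fun t ht => ?_⟩, hs⟩
  have h1 := hS s (ha hs) (fun q hq =>
    (hsS q (Finset.mem_insert_of_mem hq)).trans_le (min_le_right _ _)) t ht
  have h2 := (hsS r (Finset.mem_insert_self _ _)).trans_le (min_le_left _ _)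
  have h3 : expChar r (t + s) • f (t + s) - expChar r t • f t
      = expChar r (t + s) • (f (t + s) - f t) + (expChar r t * (expChar r s - 1)) • f t := by
    rw [smul_sub, mul_sub, ← expChar_add_right, mul_one, sub_smul]
    abel
  have h4 : ‖f t‖ ≤ |C| + 1 := (hC t ht).trans ((le_abs_self C).trans (by linarith))
  have h5 : η * (|C| + 1) = ε / 2 := by
    rw [hη]
    field_simp
  rw [h3]
  refine (norm_add_le _ _).trans ?_
  rw [norm_smul, norm_smul, norm_mul, norm_expChar, norm_expChar, one_mul, one_mul]
  have h6 := mul_le_mul h2.le h4 (norm_nonneg _) hη0.le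
  linarith

lemma intervalIntegrable_of_mem_domain (hI : I = univ ∨ I = Ici (0 : ℝ)) (hf : ContinuousOn f I)
    {a b : ℝ} (ha : a ∈ I) (hb : b ∈ I) : IntervalIntegrable f volume a b := by
  have : I.OrdConnected := by
    rcases hI with rfl | rfl
    · exact ordConnected_univ
    · exact ordConnected_Ici
  exact (hf.mono (this.uIcc_subset ha hb)).intervalIntegrable

/-- Twice an `ε / 2`-antiperiod is an `ε`-period. -/
lemma IsAlmostAntiPeriodic.isAlmostPeriodic (hf : IsAlmostAntiPeriodic I f)
    (hI : I = univ ∨ I = Ici (0 : ℝ)) : IsAlmostPeriodic I f := by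
  refine ⟨hf.1, fun ε hε => ?_⟩
  obtain ⟨l, hl, h⟩ := hf.2 (ε / 2) (by positivity)
  refine ⟨2 * l, by positivity, fun a ha => ?_⟩
  obtain ⟨τ, ⟨hτ, hτ0, hp⟩, h1, h2⟩ := h (a / 2) (by
    rcases hI with rfl | rfl
    · exact subset_univ _
    · intro x hx
      have h0 : 0 ≤ a := ha ⟨le_rfl, by linarith⟩
      exact mem_Ici.2 (by linarith [hx.1]))
  refine ⟨τ + τ, ⟨add_mem_domain hI hτ hτ, fun h0 => hτ0 (by linarith), fun t ht => ?_⟩,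
    by linarith, by linarith⟩
  have h3 := hp t ht
  have h4 := hp (t + τ) (add_mem_domain hI ht hτ)
  have h5 := norm_sub_le (f (t + τ + τ) + f (t + τ)) (f (t + τ) + f t)
  rw [show f (t + τ + τ) + f (t + τ) - (f (t + τ) + f t) = f (t + (τ + τ)) - f t by
    rw [add_assoc t τ τ]
    abel] at h5
  linarith

lemma continuousOn_comp_add_left (hI : I = univ ∨ I = Ici (0 : ℝ)) (hf : ContinuousOn f I) {t : ℝ}
    (ht : t ∈ I) : ContinuousOn (fun s => f (t + s)) I :=
  hf.comp (continuous_const_add t).continuousOn fun _ hs => add_mem_domain hI ht hs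

end Basic

/-! ### Mean values and their existence. -/

section Mean

/-- `p` is the mean value `lim_{T → ∞} (1 / T) ∫₀ᵀ f(s) ds` of `f` on the half-line. -/
def HasMean {E : Type*} [NormedAddCommGroup E] [NormedSpace ℝ E] (f : ℝ → E) (p : E) : Prop :=
  Tendsto (fun T : ℝ => (1 / T) • ∫ s in (0 : ℝ)..T, f s) atTop (𝓝 p)

variable {E : Type*} [NormedAddCommGroup E] [NormedSpace ℝ E] {I : Set ℝ} {f g : ℝ → E} {p q : E}

lemma HasMean.unique (hp : HasMean f p) (hq : HasMean f q) : p = q :=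
  tendsto_nhds_unique hp hq

lemma HasMean.add (hI : I = univ ∨ I = Ici (0 : ℝ)) (hfc : ContinuousOn f I)
    (hgc : ContinuousOn g I) (hf : HasMean f p) (hg : HasMean g q) :
    HasMean (fun s => f s + g s) (p + q) := by
  refine (Tendsto.add hf hg).congr' ?_
  filter_upwards [eventually_ge_atTop 0] with T hT
  have h0 := mem_of_nonneg hI le_rfl
  have hT' := mem_of_nonneg hI hT
  rw [intervalIntegral.integral_add (intervalIntegrable_of_mem_domain hI hfc h0 hT')
    (intervalIntegrable_of_mem_domain hI hgc h0 hT'), smul_add]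

lemma HasMean.const_smul {𝕜 : Type*} [RCLike 𝕜] [NormedSpace 𝕜 E] [SMulCommClass ℝ 𝕜 E]
    (c : 𝕜) (hf : HasMean f p) : HasMean (fun s => c • f s) (c • p) := by
  refine (Tendsto.const_smul hf c).congr fun T => ?_
  rw [intervalIntegral.integral_smul, smul_comm]

lemma HasMean.sub (hI : I = univ ∨ I = Ici (0 : ℝ)) (hfc : ContinuousOn f I)
    (hgc : ContinuousOn g I) (hf : HasMean f p) (hg : HasMean g q) :
    HasMean (fun s => f s - g s) (p - q) := by
  have h := hf.add hI hfc (hgc.const_smul (-1 : ℝ)) (hg.const_smul (-1 : ℝ))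
  simpa [sub_eq_add_neg] using h

lemma hasMean_const [CompleteSpace E] (p : E) : HasMean (fun _ => p) p := by
  refine tendsto_const_nhds.congr' ?_
  filter_upwards [eventually_gt_atTop 0] with T hT
  rw [intervalIntegral.integral_const, sub_zero, smul_smul, one_div, inv_mul_cancel₀ hT.ne',
    one_smul]

lemma HasMean.comp_add_right (hI : I = univ ∨ I = Ici (0 : ℝ)) (hfc : ContinuousOn f I)
    (hf : HasMean f p) {t : ℝ} (ht : t ∈ I) : HasMean (fun s => f (s + t)) p := by
  have h0 : (0 : ℝ) ∈ I := mem_of_nonneg hI le_rfl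
  have h1 : Tendsto (fun T : ℝ => T + t) atTop atTop := tendsto_atTop_add_const_right _ _ tendsto_id
  have h2 : Tendsto (fun T : ℝ => 1 + T⁻¹ * t) atTop (𝓝 1) := by
    simpa using (tendsto_inv_atTop_zero.mul_const t).const_add (1 : ℝ)
  have h3 : Tendsto (fun T : ℝ => T⁻¹ • ∫ s in (0 : ℝ)..t, f s) atTop (𝓝 0) := by
    simpa using (tendsto_inv_atTop_zero (𝕜 := ℝ)).smul_const (∫ s in (0 : ℝ)..t, f s)
  have h4 := (h2.smul (hf.comp h1)).sub h3
  rw [one_smul, sub_zero] at h4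
  refine h4.congr' ?_
  filter_upwards [eventually_gt_atTop 0, eventually_gt_atTop (-t)] with T hT hTt
  have hT' : T + t ≠ 0 := by linarith
  simp only [Function.comp_apply]
  rw [intervalIntegral.integral_comp_add_right, zero_add, ← intervalIntegral.integral_interval_sub_left
    (intervalIntegrable_of_mem_domain hI hfc h0 (mem_of_nonneg hI (by linarith)))
    (intervalIntegrable_of_mem_domain hI hfc h0 ht), smul_sub, smul_smul, one_div, one_div]
  congr 2
  field_simp

lemma HasMean.norm_le_of_norm_le {h : ℝ → ℝ} {c : ℝ} (hI : I = univ ∨ I = Ici (0 : ℝ))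
    (hhc : ContinuousOn h I) (hf : HasMean f p) (hh : HasMean h c)
    (hle : ∀ s, 0 ≤ s → ‖f s‖ ≤ h s) : ‖p‖ ≤ c := by
  refine le_of_tendsto_of_tendsto hf.norm hh ?_
  filter_upwards [eventually_gt_atTop 0] with T hT
  rw [norm_smul, smul_eq_mul, Real.norm_of_nonneg (by positivity)]
  refine mul_le_mul_of_nonneg_left ?_ (by positivity)
  exact intervalIntegral.norm_integral_le_of_norm_le hT.le
    (Eventually.of_forall fun s hs => hle s hs.1.le)
    (intervalIntegrable_of_mem_domain hI hhc (mem_of_nonneg hI le_rfl) (mem_of_nonneg hI hT.le))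

lemma HasMean.norm_le {c : ℝ} (hf : HasMean f p) (hle : ∀ s, 0 ≤ s → ‖f s‖ ≤ c) : ‖p‖ ≤ c :=
  hf.norm_le_of_norm_le (.inl rfl) continuousOn_const (hasMean_const c) hle

/-- An almost period moves the window `[a, a + T]` to one starting in `[0, l]`, which differs from
`[0, T]` only by end pieces of length at most `l`. These cost `2 * C * l`, negligible against `T`.
-/
lemma IsAlmostPeriodic.exists_integral_translate_le (hf : IsAlmostPeriodic I f)
    (hI : I = univ ∨ I = Ici (0 : ℝ)) {ε : ℝ} (hε : 0 < ε) :
    ∃ T : ℝ, 0 < T ∧ ∀ a : ℝ, 0 ≤ a →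
      ‖(∫ s in a..a + T, f s) - ∫ s in (0 : ℝ)..T, f s‖ ≤ ε * T := by
  obtain ⟨C, hC⟩ := hf.exists_bound hI
  have hC0 : 0 ≤ C := (norm_nonneg _).trans (hC 0 (mem_of_nonneg hI le_rfl))
  obtain ⟨l, hl, h⟩ := hf.exists_sub_mem_Icc hI (show 0 < ε / 2 by positivity)
  set T : ℝ := 4 * C * l / ε + 1 with hT
  have hT0 : 0 < T := by positivity
  refine ⟨T, hT0, fun a ha => ?_⟩
  obtain ⟨τ, hτ, hu, hp⟩ := h a (mem_of_nonneg hI ha)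
  set u := a - τ with hu'
  have ii : ∀ {x y : ℝ}, 0 ≤ x → 0 ≤ y → IntervalIntegrable f volume x y := fun hx hy =>
    intervalIntegrable_of_mem_domain hI hf.1 (mem_of_nonneg hI hx) (mem_of_nonneg hI hy)
  have hii : IntervalIntegrable (fun s => f (s + τ)) volume u (u + T) := by
    have h1 := (ii ha (show 0 ≤ a + T by positivity)).comp_add_right (c := τ)
    rwa [show a + T - τ = u + T by rw [hu']; ring] at h1
  have h1 : (∫ s in a..a + T, f s) = ∫ s in u..u + T, f (s + τ) := by
    rw [intervalIntegral.integral_comp_add_right]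
    congr 1 <;> rw [hu'] <;> ring
  have h2 : ‖(∫ s in u..u + T, f (s + τ)) - ∫ s in u..u + T, f s‖ ≤ ε / 2 * T := by
    rw [← intervalIntegral.integral_sub hii (ii hu.1 (add_nonneg hu.1 hT0.le))]
    refine (intervalIntegral.norm_integral_le_of_norm_le_const (C := ε / 2) fun s hs => ?_).trans ?_
    · rw [uIoc_of_le (by linarith)] at hs
      exact hp s (mem_of_nonneg hI (hu.1.trans hs.1.le))
    · rw [add_sub_cancel_left, abs_of_pos hT0]
  have hbd : ∀ x y : ℝ, 0 ≤ x → x ≤ y → ‖∫ s in x..y, f s‖ ≤ C * (y - x) := by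
    intro x y hx hxy
    refine (intervalIntegral.norm_integral_le_of_norm_le_const (C := C) fun s hs => ?_).trans ?_
    · rw [uIoc_of_le hxy] at hs
      exact hC s (mem_of_nonneg hI (hx.trans hs.1.le))
    · rw [abs_of_nonneg (sub_nonneg.2 hxy)]
  have h3 : (∫ s in u..u + T, f s) - ∫ s in (0 : ℝ)..T, f s
      = (∫ s in T..u + T, f s) - ∫ s in (0 : ℝ)..u, f s := by
    have e1 := intervalIntegral.integral_add_adjacent_intervals (ii le_rfl hu.1)
      (ii hu.1 (add_nonneg hu.1 hT0.le))
    have e2 := intervalIntegral.integral_add_adjacent_intervals (ii le_rfl hT0.le)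
      (ii hT0.le (add_nonneg hu.1 hT0.le))
    rw [sub_eq_sub_iff_add_eq_add, add_comm, e1, ← e2, add_comm]
  have h4 : ‖(∫ s in u..u + T, f s) - ∫ s in (0 : ℝ)..T, f s‖ ≤ 2 * (C * l) := by
    rw [h3]
    have b1 := hbd T (u + T) hT0.le (by linarith [hu.1])
    have b2 := hbd 0 u le_rfl hu.1
    have b3 := mul_le_mul_of_nonneg_left hu.2 hC0
    refine (norm_sub_le _ _).trans ?_
    rw [add_sub_cancel_right] at b1
    rw [sub_zero] at b2
    linarith
  have h5 : 2 * (C * l) ≤ ε / 2 * T := by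
    rw [hT, mul_add, show ε / 2 * (4 * C * l / ε) = 2 * (C * l) by field_simp; ring]
    linarith
  rw [h1]
  have h6 := norm_sub_le_norm_sub_add_norm_sub (∫ s in u..u + T, f (s + τ)) (∫ s in u..u + T, f s)
    (∫ s in (0 : ℝ)..T, f s)
  linarith

lemma IsAlmostPeriodic.eventually_mean_near (hf : IsAlmostPeriodic I f)
    (hI : I = univ ∨ I = Ici (0 : ℝ)) {ε : ℝ} (hε : 0 < ε) :
    ∃ p : E, ∀ᶠ T : ℝ in atTop, ‖(1 / T) • (∫ s in (0 : ℝ)..T, f s) - p‖ ≤ ε := by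
  obtain ⟨C, hC⟩ := hf.exists_bound hI
  have hC0 : 0 ≤ C := (norm_nonneg _).trans (hC 0 (mem_of_nonneg hI le_rfl))
  obtain ⟨T₀, hT₀, h⟩ := hf.exists_integral_translate_le hI (show 0 < ε / 2 by positivity)
  have ii : ∀ {x y : ℝ}, 0 ≤ x → 0 ≤ y → IntervalIntegrable f volume x y := fun hx hy =>
    intervalIntegrable_of_mem_domain hI hf.1 (mem_of_nonneg hI hx) (mem_of_nonneg hI hy)
  have hbd : ∀ x y : ℝ, 0 ≤ x → x ≤ y → ‖∫ s in x..y, f s‖ ≤ C * (y - x) := by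
    intro x y hx hxy
    refine (intervalIntegral.norm_integral_le_of_norm_le_const (C := C) fun s hs => ?_).trans ?_
    · rw [uIoc_of_le hxy] at hs
      exact hC s (mem_of_nonneg hI (hx.trans hs.1.le))
    · rw [abs_of_nonneg (sub_nonneg.2 hxy)]
  set J := ∫ s in (0 : ℝ)..T₀, f s with hJ
  have hJle : ‖J‖ ≤ C * T₀ := by simpa using hbd 0 T₀ le_rfl hT₀.le
  have hmul : ∀ n : ℕ, ‖(∫ s in (0 : ℝ)..n * T₀, f s) - (n : ℝ) • J‖ ≤ n * (ε / 2 * T₀) := by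
    intro n
    induction n with
    | zero => simp
    | succ n ih =>
      have hn : 0 ≤ n * T₀ := by positivity
      have e1 := intervalIntegral.integral_add_adjacent_intervals (ii le_rfl hn)
        (ii hn (show 0 ≤ n * T₀ + T₀ by positivity))
      have e2 := h (n * T₀) hn
      push_cast
      rw [add_mul, one_mul, ← e1, add_smul, one_smul, add_sub_add_comm]
      refine (norm_add_le _ _).trans ?_
      linarith
  refine ⟨(1 / T₀) • J, ?_⟩
  -- The incomplete last block and the replacement of `T / T₀` by its floor each cost at most `C *
  -- T₀`.
  filter_upwards [eventually_gt_atTop 0, eventually_ge_atTop (4 * C * T₀ / ε)] with T hT hT2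
  have hT2' : 2 * (C * T₀) ≤ ε / 2 * T := by
    rw [div_le_iff₀ hε] at hT2
    linarith
  set n := ⌊T / T₀⌋₊ with hn
  have hn1 : (n : ℝ) * T₀ ≤ T := (le_div_iff₀ hT₀).1 (Nat.floor_le (by positivity))
  have hn2 : T < (n + 1 : ℝ) * T₀ := (div_lt_iff₀ hT₀).1 (Nat.lt_floor_add_one _)
  have hn0 : 0 ≤ (n : ℝ) * T₀ := by positivity
  have e1 := intervalIntegral.integral_add_adjacent_intervals (ii le_rfl hn0) (ii hn0 hT.le)
  have e2 : (1 / T) • (∫ s in (0 : ℝ)..T, f s) - (1 / T₀) • J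
      = (1 / T) • ((∫ s in (0 : ℝ)..n * T₀, f s) - (n : ℝ) • J + (∫ s in (n * T₀)..T, f s)
        - (T / T₀ - n) • J) := by
    have e3 : (1 / T₀) • J = (1 / T) • ((T / T₀) • J) := by
      rw [smul_smul]
      congr 1
      field_simp
    rw [e3, ← e1, ← smul_sub, sub_smul]
    congr 1
    abel
  rw [e2, norm_smul, Real.norm_of_nonneg (by positivity), one_div, inv_mul_le_iff₀ hT]
  have b1 := hmul n
  have b2 := hbd (n * T₀) T hn0 hn1
  have b3 : ‖(T / T₀ - n) • J‖ ≤ (T / T₀ - n) * (C * T₀) := by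
    rw [norm_smul, Real.norm_of_nonneg (sub_nonneg.2 (Nat.floor_le (by positivity)))]
    exact mul_le_mul_of_nonneg_left hJle (sub_nonneg.2 (Nat.floor_le (by positivity)))
  have b4 : (T / T₀ - n) * (C * T₀) = C * (T - n * T₀) := by field_simp
  have b5 : C * (T - n * T₀) ≤ C * T₀ := mul_le_mul_of_nonneg_left (by linarith) hC0
  have b6 : n * (ε / 2 * T₀) ≤ ε / 2 * T := by nlinarith
  refine (norm_sub_le _ _).trans ?_
  have b7 := norm_add_le ((∫ s in (0 : ℝ)..n * T₀, f s) - (n : ℝ) • J) (∫ s in (n * T₀)..T, f s)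
  linarith

/-- An almost periodic function has a mean value. -/
lemma IsAlmostPeriodic.exists_hasMean [CompleteSpace E] (hf : IsAlmostPeriodic I f)
    (hI : I = univ ∨ I = Ici (0 : ℝ)) : ∃ p : E, HasMean f p := by
  refine cauchy_map_iff_exists_tendsto.1 (Metric.cauchy_iff.2 ⟨inferInstance, fun ε hε => ?_⟩)
  obtain ⟨p, hp⟩ := hf.eventually_mean_near hI (show 0 < ε / 3 by positivity)
  refine ⟨Metric.closedBall p (ε / 3), ?_, fun x hx y hy => ?_⟩
  · rw [Filter.mem_map]
    filter_upwards [hp] with T hT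
    rwa [mem_preimage, Metric.mem_closedBall, dist_eq_norm]
  · have := dist_triangle_right x y p
    rw [Metric.mem_closedBall] at hx hy
    linarith

/-- By translation invariance `f (s + τ) + f s` has mean `p + p`, while for an antiperiod `τ` its
norm is at most `ε`. -/
lemma IsAlmostAntiPeriodic.hasMean_zero [CompleteSpace E] (hf : IsAlmostAntiPeriodic I f)
    (hI : I = univ ∨ I = Ici (0 : ℝ)) : HasMean f 0 := by
  obtain ⟨p, hp⟩ := (hf.isAlmostPeriodic hI).exists_hasMean hI
  have key : ∀ ε > 0, ‖p + p‖ ≤ ε := by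
    intro ε hε
    obtain ⟨l, hl, h⟩ := hf.2 ε hε
    obtain ⟨τ, ⟨hτ, -, hτp⟩, -⟩ := h 0 fun x hx => mem_of_nonneg hI hx.1
    have hc : ContinuousOn (fun s => f (s + τ)) I :=
      hf.1.comp (continuous_add_const τ).continuousOn fun s hs => add_mem_domain hI hs hτ
    exact ((hp.comp_add_right hI hf.1 hτ).add hI hc hf.1 hp).norm_le fun s hs =>
      hτp s (mem_of_nonneg hI hs)
  have h0 : p + p = 0 := norm_le_zero_iff.1 (le_of_forall_pos_le_add fun ε hε => by
    simpa using key ε hε)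
  rw [← two_smul ℝ, smul_eq_zero_iff_right two_ne_zero] at h0
  rwa [h0] at hp

end Mean

/-! ### Vanishing of the mean on `ANP`. -/

section AntiperiodicSpan

variable {X : Type*} [NormedAddCommGroup X] [NormedSpace ℂ X] {I : Set ℝ} {f : ℝ → X} {p : X}

lemma isBohrTransform_iff {r : ℝ} :
    IsBohrTransform f r p ↔ HasMean (fun s => expChar (-r) s • f s) p := by
  simp only [IsBohrTransform, HasMean, exp_neg_eq_expChar]

variable [CompleteSpace X]

lemma hasMean_zero_of_mem_ANP₀ (hI : I = univ ∨ I = Ici (0 : ℝ)) (hf : f ∈ ANP₀ X I) :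
    ContinuousOn f I ∧ HasMean f 0 := by
  induction hf using Submodule.span_induction with
  | mem g hg => exact ⟨hg.1, IsAlmostAntiPeriodic.hasMean_zero hg hI⟩
  | zero => exact ⟨continuousOn_const, hasMean_const 0⟩
  | add g h _ _ hg hh =>
    exact ⟨hg.1.add hh.1, by
      have h0 := hg.2.add hI hg.1 hh.1 hh.2
      rwa [add_zero] at h0⟩
  | smul c g _ hg => exact ⟨hg.1.const_smul c, by
      have h0 := hg.2.const_smul c
      rwa [smul_zero] at h0⟩

lemma eq_zero_of_mem_ANP (hI : I = univ ∨ I = Ici (0 : ℝ)) (hf : f ∈ ANP X I)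
    (hp : HasMean f p) : p = 0 := by
  refine norm_le_zero_iff.1 (le_of_forall_pos_le_add fun ε hε => ?_)
  obtain ⟨g, hg, hfg⟩ := hf.2 ε hε
  obtain ⟨hgc, hg0⟩ := hasMean_zero_of_mem_ANP₀ hI hg
  have h := (hp.sub hI hf.1.1 hgc hg0).norm_le fun s hs => hfg s (mem_of_nonneg hI hs)
  simpa using h

end AntiperiodicSpan

/-! ### Trigonometric polynomials with nonnegative coefficients. -/

section PositiveTrigPoly

open scoped NNReal

/-- The trigonometric polynomials with nonnegative coefficients. -/
noncomputable def posTrigPoly : Submodule ℝ≥0 (ℝ → ℂ) := Submodule.span ℝ≥0 (range expChar)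

lemma expChar_mem_posTrigPoly (r : ℝ) : expChar r ∈ posTrigPoly :=
  Submodule.subset_span (mem_range_self r)

lemma one_mem_posTrigPoly : (1 : ℝ → ℂ) ∈ posTrigPoly := by
  have h : (1 : ℝ → ℂ) = expChar 0 := funext fun t => (expChar_zero_left t).symm
  rw [h]
  exact expChar_mem_posTrigPoly 0

lemma mul_mem_posTrigPoly {q w : ℝ → ℂ} (hq : q ∈ posTrigPoly) (hw : w ∈ posTrigPoly) :
    q * w ∈ posTrigPoly := by
  have h := Submodule.mul_mem_mul hq hw
  rw [posTrigPoly, Submodule.span_mul_span] at h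
  refine Submodule.span_mono ?_ h
  rintro _ ⟨_, ⟨r, rfl⟩, _, ⟨s, rfl⟩, rfl⟩
  exact ⟨r + s, funext fun t => expChar_add_left r s t⟩

lemma pow_mem_posTrigPoly {q : ℝ → ℂ} (hq : q ∈ posTrigPoly) (n : ℕ) : q ^ n ∈ posTrigPoly := by
  induction n with
  | zero => exact one_mem_posTrigPoly
  | succ n ih =>
    rw [pow_succ]
    exact mul_mem_posTrigPoly ih hq

lemma continuous_of_mem_posTrigPoly {q : ℝ → ℂ} (hq : q ∈ posTrigPoly) : Continuous q := by
  induction hq using Submodule.span_induction with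
  | mem q hq =>
    obtain ⟨r, rfl⟩ := hq
    exact continuous_expChar r
  | zero => exact continuous_const
  | add q w _ _ hq hw => exact hq.add hw
  | smul c q _ hq => exact hq.const_smul c

/-- The translates of `π / r` by multiples of `2π / |r|` are exact antiperiods. -/
lemma isAlmostAntiPeriodic_expChar_smul {X : Type*} [NormedAddCommGroup X] [NormedSpace ℂ X]
    {I : Set ℝ} {r : ℝ} (hr : r ≠ 0) (x : X) : IsAlmostAntiPeriodic I fun t => expChar r t • x := by
  refine ⟨((continuous_expChar r).smul continuous_const).continuousOn, fun ε hε => ?_⟩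
  set v := Real.pi / r with hv
  have hvr : expChar r v = -1 := by
    rw [expChar_eq, hv, mul_div_cancel₀ _ hr, mul_comm, Complex.exp_pi_mul_I]
  have hvv : ∀ m : ℤ, expChar r (m * (2 * v)) = 1 := by
    intro m
    rw [expChar_eq, hv, Complex.exp_eq_one_iff]
    refine ⟨m, ?_⟩
    rw [show r * (m * (2 * (Real.pi / r))) = m * (2 * Real.pi) by field_simp]
    push_cast
    ring
  refine ⟨2 * |v|, by positivity, fun a ha => ?_⟩
  obtain ⟨m, hm, -⟩ := existsUnique_add_zsmul_mem_Ico (show 0 < 2 * |v| by positivity) v a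
  have hτ : expChar r (v + m • (2 * |v|)) = -1 := by
    rw [expChar_add_right, hvr, zsmul_eq_mul]
    rcases abs_choice v with h | h
    · rw [h, hvv, mul_one]
    · rw [h, show (m : ℝ) * (2 * -v) = (-m : ℤ) * (2 * v) by push_cast; ring, hvv, mul_one]
  refine ⟨_, ⟨ha (Ico_subset_Icc_self hm), fun h0 => ?_, fun t _ => ?_⟩, Ico_subset_Icc_self hm⟩
  · rw [h0, expChar_zero_right] at hτ
    norm_num at hτ
  · dsimp only
    rw [expChar_add_right, hτ, mul_neg_one, neg_smul, neg_add_cancel, norm_zero]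
    exact hε.le

lemma hasMean_expChar {r : ℝ} (hr : r ≠ 0) : HasMean (expChar r) 0 := by
  have h := (isAlmostAntiPeriodic_expChar_smul (I := univ) hr (1 : ℂ)).hasMean_zero (.inl rfl)
  simpa using h

lemma exists_hasMean_of_mem_posTrigPoly {q : ℝ → ℂ} (hq : q ∈ posTrigPoly) :
    ∃ c : ℝ, 0 ≤ c ∧ HasMean q (c : ℂ) := by
  induction hq using Submodule.span_induction with
  | mem q hq =>
    obtain ⟨r, rfl⟩ := hq
    by_cases hr : r = 0
    · refine ⟨1, zero_le_one, ?_⟩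
      rw [hr, funext expChar_zero_left, Complex.ofReal_one]
      exact hasMean_const 1
    · exact ⟨0, le_rfl, hasMean_expChar hr⟩
  | zero => exact ⟨0, le_rfl, hasMean_const 0⟩
  | add q w hq' hw' hq hw =>
    obtain ⟨c, hc, hqc⟩ := hq
    obtain ⟨d, hd, hwd⟩ := hw
    refine ⟨c + d, add_nonneg hc hd, ?_⟩
    rw [Complex.ofReal_add]
    exact hqc.add (.inl rfl) (continuous_of_mem_posTrigPoly hq').continuousOn
      (continuous_of_mem_posTrigPoly hw').continuousOn hwd
  | smul a q _ hq =>
    obtain ⟨c, hc, hqc⟩ := hq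
    refine ⟨a * c, by positivity, ?_⟩
    have h := hqc.const_smul (a : ℝ)
    rwa [Complex.real_smul, ← Complex.ofReal_mul] at h

end PositiveTrigPoly

/-! ### A kernel concentrated on a Bohr set. -/

section Kernel

open scoped NNReal

/-- The function `s ↦ cos (rs / 2)`. -/
noncomputable def halfCos (r : ℝ) : ℝ → ℂ := fun s => (Real.cos (r * s / 2) : ℂ)

lemma halfCos_eq (r : ℝ) :
    halfCos r = (2⁻¹ : ℝ≥0) • (expChar (r / 2) + expChar (-(r / 2))) := by
  funext s
  have h1 : expChar (r / 2) s = Complex.exp (((r * s / 2 : ℝ) : ℂ) * Complex.I) := by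
    rw [expChar]
    congr 1
    push_cast
    ring
  have h2 : expChar (-(r / 2)) s = Complex.exp (-((r * s / 2 : ℝ) : ℂ) * Complex.I) := by
    rw [expChar]
    congr 1
    push_cast
    ring
  simp only [Pi.smul_apply, Pi.add_apply]
  rw [h1, h2, halfCos, Complex.ofReal_cos, Complex.cos, NNReal.smul_def, Complex.real_smul]
  push_cast
  ring

/-- The middle term of the binomial expansion is the constant singled out. -/
lemma halfCos_pow_eq (r : ℝ) (m : ℕ) :
    ∃ n ∈ posTrigPoly,
      halfCos r ^ (2 * m) = ((m.centralBinom / 4 ^ m : ℝ≥0) • (1 : ℝ → ℂ)) + n := by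
  have hmem : ∀ k ∈ Finset.range (2 * m + 1),
      expChar (r / 2) ^ k * expChar (-(r / 2)) ^ (2 * m - k) * ((2 * m).choose k : ℝ → ℂ)
        ∈ posTrigPoly := by
    intro k _
    rw [mul_comm, ← nsmul_eq_mul]
    exact nsmul_mem (mul_mem_posTrigPoly (pow_mem_posTrigPoly (expChar_mem_posTrigPoly _) _)
      (pow_mem_posTrigPoly (expChar_mem_posTrigPoly _) _)) _
  have hone : expChar (r / 2) * expChar (-(r / 2)) = 1 := by
    funext t
    rw [Pi.mul_apply, ← expChar_add_left, add_neg_cancel, expChar_zero_left, Pi.one_apply]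
  have hmm : m ∈ Finset.range (2 * m + 1) := Finset.mem_range.2 (by omega)
  refine ⟨((2⁻¹ : ℝ≥0) ^ (2 * m)) • ∑ k ∈ (Finset.range (2 * m + 1)).erase m,
    expChar (r / 2) ^ k * expChar (-(r / 2)) ^ (2 * m - k) * ((2 * m).choose k : ℝ → ℂ),
    Submodule.smul_mem _ _ (Submodule.sum_mem _ fun k hk => hmem k (Finset.mem_of_mem_erase hk)), ?_⟩
  rw [halfCos_eq, smul_pow, add_pow, ← Finset.add_sum_erase _ _ hmm, smul_add]
  congr 1
  rw [show 2 * m - m = m by omega, ← mul_pow, hone, one_pow, one_mul, ← nsmul_one, ← Nat.centralBinom,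
    ← Nat.cast_smul_eq_nsmul ℝ≥0, smul_smul]
  congr 1
  rw [pow_mul, inv_pow, inv_pow, mul_comm, div_eq_mul_inv]
  norm_num

/-- Relations among the frequencies in `S` may create further constant terms, but positivity of the
coefficients means that these only increase the mean. -/
lemma prod_halfCos_pow_eq (S : Finset ℝ) (m : ℕ) :
    ∃ n ∈ posTrigPoly, ∏ r ∈ S, halfCos r ^ (2 * m)
      = (((m.centralBinom / 4 ^ m : ℝ≥0) ^ S.card) • (1 : ℝ → ℂ)) + n := by
  classical
  induction S using Finset.induction_on with
  | empty => exact ⟨0, zero_mem _, by simp⟩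
  | insert r S hr ih =>
    obtain ⟨n, hn, hSn⟩ := ih
    obtain ⟨n', hn', hrn⟩ := halfCos_pow_eq r m
    set c : ℝ≥0 := m.centralBinom / 4 ^ m with hc
    refine ⟨c • n + (c ^ S.card • n' + n' * n), add_mem (Submodule.smul_mem _ _ hn)
      (add_mem (Submodule.smul_mem _ _ hn') (mul_mem_posTrigPoly hn' hn)), ?_⟩
    rw [Finset.prod_insert hr, hSn, hrn, Finset.card_insert_of_notMem hr, add_mul, mul_add, mul_add,
      smul_mul_smul_comm, one_mul, smul_one_mul, mul_smul_one, ← pow_succ', add_assoc]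

lemma sq_halfCos (r s : ℝ) :
    Real.cos (r * s / 2) ^ 2 = 1 - ‖expChar r s - 1‖ ^ 2 / 4 := by
  rw [expChar_eq, Complex.norm_exp_I_mul_ofReal_sub_one, Real.norm_eq_abs, sq_abs, mul_pow,
    Real.sin_sq]
  ring

/-- A nonnegative trigonometric kernel that is concentrated on the Bohr set defined by `S`:
off this set it is small compared with its mean value. -/
lemma exists_kernel (S : Finset ℝ) {δ : ℝ} (hδ : 0 < δ) :
    ∃ (Q : ℝ → ℝ) (c : ℝ), (fun s => (Q s : ℂ)) ∈ posTrigPoly ∧ (∀ s, 0 ≤ Q s) ∧ 0 < c ∧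
      HasMean Q c ∧ ∀ s, (∃ r ∈ S, 1 / 4 ≤ ‖expChar r s - 1‖) → Q s ≤ δ * c := by
  -- Off the Bohr set some factor is at most `(63 / 64) ^ m`, where `63 / 64 = 1 - (1 / 4) ^ 2 / 4`.
  -- The mean is at least `(2 * m) ^ (-|S|)`, by the bound on the central binomial coefficient, so
  -- exponential decay beats it.
  have hlim : Tendsto (fun m : ℕ => 2 ^ S.card * ((m : ℝ) ^ S.card * (63 / 64 : ℝ) ^ m)) atTop (𝓝 0) := by
    simpa using (tendsto_pow_const_mul_const_pow_of_abs_lt_one S.card (r := 63 / 64)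
      (by rw [abs_of_pos] <;> norm_num)).const_mul ((2 : ℝ) ^ S.card)
  obtain ⟨m, hm, hm0⟩ := ((hlim.eventually_lt_const hδ).and (eventually_gt_atTop 0)).exists
  set Q : ℝ → ℝ := fun s => ∏ r ∈ S, (Real.cos (r * s / 2) ^ 2) ^ m with hQ
  have hQeq : (fun s => (Q s : ℂ)) = ∏ r ∈ S, halfCos r ^ (2 * m) := by
    funext s
    simp only [hQ, Finset.prod_apply, Pi.pow_apply, halfCos, Complex.ofReal_prod, Complex.ofReal_pow,
      pow_mul]
  obtain ⟨n, hn, hQn⟩ := prod_halfCos_pow_eq S m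
  set a : ℝ≥0 := m.centralBinom / 4 ^ m with ha
  rw [← hQeq] at hQn
  have h1 : (a ^ S.card) • (1 : ℝ → ℂ) ∈ posTrigPoly :=
    Submodule.smul_mem _ _ one_mem_posTrigPoly
  obtain ⟨d, hd, hnd⟩ := exists_hasMean_of_mem_posTrigPoly hn
  have hpos : (0 : ℝ) < m.centralBinom := by exact_mod_cast m.centralBinom_pos
  have ha0 : (0 : ℝ) < a := by
    rw [ha]
    push_cast
    positivity
  have hale : 1 ≤ 2 * m * (a : ℝ) := by
    rw [ha]
    push_cast
    rw [mul_div_assoc', le_div_iff₀ (by positivity), one_mul]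
    exact_mod_cast Nat.four_pow_le_two_mul_self_mul_centralBinom m hm0
  have hmean : HasMean (fun s => (Q s : ℂ)) (((a : ℝ) ^ S.card + d : ℝ) : ℂ) := by
    rw [hQn, Complex.ofReal_add]
    refine HasMean.add (.inl rfl) (continuous_of_mem_posTrigPoly h1).continuousOn
      (continuous_of_mem_posTrigPoly hn).continuousOn ?_ hnd
    have h2 := hasMean_const (((a : ℝ) ^ S.card : ℝ) : ℂ)
    convert h2 using 2 with s
    simp [NNReal.smul_def]
  have hfac : ∀ r s : ℝ, 0 ≤ (Real.cos (r * s / 2) ^ 2) ^ m := fun r s => by positivity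
  refine ⟨Q, (a : ℝ) ^ S.card + d, hQn ▸ add_mem h1 hn, fun s => Finset.prod_nonneg fun r _ => hfac r s,
    by positivity, ?_, ?_⟩
  · have h2 := (Complex.continuous_re.tendsto _).comp hmean
    rw [Complex.ofReal_re] at h2
    refine h2.congr fun T => ?_
    rw [Function.comp_apply, intervalIntegral.integral_ofReal, Complex.real_smul, ← Complex.ofReal_mul,
      Complex.ofReal_re, smul_eq_mul]
  · rintro s ⟨r, hr, hrs⟩
    have h2 : (Real.cos (r * s / 2) ^ 2) ^ m ≤ (63 / 64) ^ m := by
      refine pow_le_pow_left₀ (by positivity) ?_ m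
      rw [sq_halfCos]
      nlinarith
    have h3 : Q s ≤ (63 / 64) ^ m := by
      rw [hQ]
      simp only
      rw [← Finset.mul_prod_erase S _ hr]
      refine (mul_le_of_le_one_right (hfac r s) ?_).trans h2
      exact Finset.prod_le_one (fun r _ => hfac r s) fun r _ =>
        pow_le_one₀ (by positivity) (Real.cos_sq_le_one _)
    have h4 : 1 ≤ (2 * m) ^ S.card * (a : ℝ) ^ S.card := by
      rw [← mul_pow]
      exact one_le_pow₀ hale
    have h5 : (63 / 64 : ℝ) ^ m ≤ δ * (a : ℝ) ^ S.card := by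
      have h6 : (63 / 64 : ℝ) ^ m * (2 * m) ^ S.card ≤ δ := by
        rw [mul_pow]
        linarith
      have h7 : (0 : ℝ) ≤ (63 / 64 : ℝ) ^ m := by positivity
      calc (63 / 64 : ℝ) ^ m ≤ (63 / 64 : ℝ) ^ m * ((2 * m) ^ S.card * (a : ℝ) ^ S.card) :=
            le_mul_of_one_le_right h7 h4
        _ = ((63 / 64 : ℝ) ^ m * (2 * m) ^ S.card) * (a : ℝ) ^ S.card := by ring
        _ ≤ δ * (a : ℝ) ^ S.card := by gcongr
    have h8 : 0 ≤ δ * d := by positivity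
    linarith

end Kernel

/-! ### Approximation of functions with mean zero. -/

section Approximation

variable {X : Type*} [NormedAddCommGroup X] [NormedSpace ℂ X] [CompleteSpace X] {I : Set ℝ}
  {f : ℝ → X}

/-- Substituting `s + t` for `s` gives `G t = e^{-irt} x`, with `x` the mean of `e^{irs} f(s)`. Mean
zero is needed exactly at `r = 0`, where `G` is constant. -/
lemma exists_hasMean_expChar_smul (hI : I = univ ∨ I = Ici (0 : ℝ)) (hf : IsAlmostPeriodic I f)
    (hf0 : HasMean f 0) (r : ℝ) :
    ∃ G ∈ ANP₀ X I, ∀ t ∈ I, HasMean (fun s => expChar r s • f (t + s)) (G t) := by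
  have hr := hf.expChar_smul hI r
  obtain ⟨x, hx⟩ := hr.exists_hasMean hI
  refine ⟨fun t => expChar (-r) t • x, ?_, fun t ht => ?_⟩
  · by_cases h0 : r = 0
    · have hx0 : x = 0 := by
        simp only [h0, expChar_zero_left, one_smul] at hx
        exact hx.unique hf0
      simp only [hx0, smul_zero]
      exact zero_mem _
    · exact Submodule.subset_span (isAlmostAntiPeriodic_expChar_smul (neg_ne_zero.2 h0) x)
  · have h1 := (hx.comp_add_right hI hr.1 ht).const_smul (expChar (-r) t)
    convert h1 using 2 with s
    rw [smul_smul, expChar_add_right, mul_comm (expChar r s), ← mul_assoc, ← expChar_add_left,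
      neg_add_cancel, expChar_zero_left, one_mul, add_comm]

lemma exists_hasMean_smul_of_mem_posTrigPoly (hI : I = univ ∨ I = Ici (0 : ℝ))
    (hf : IsAlmostPeriodic I f) (hf0 : HasMean f 0) {q : ℝ → ℂ} (hq : q ∈ posTrigPoly) :
    ∃ G ∈ ANP₀ X I, ∀ t ∈ I, HasMean (fun s => q s • f (t + s)) (G t) := by
  induction hq using Submodule.span_induction with
  | mem q hq =>
    obtain ⟨r, rfl⟩ := hq
    exact exists_hasMean_expChar_smul hI hf hf0 r
  | zero => exact ⟨0, zero_mem _, fun t _ => by simpa using hasMean_const (0 : X)⟩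
  | add q w hq' hw' hq hw =>
    obtain ⟨G, hG, hqG⟩ := hq
    obtain ⟨H, hH, hwH⟩ := hw
    refine ⟨G + H, add_mem hG hH, fun t ht => ?_⟩
    have hc := continuousOn_comp_add_left hI hf.1 ht
    simp only [Pi.add_apply, add_smul]
    exact (hqG t ht).add hI ((continuous_of_mem_posTrigPoly hq').continuousOn.smul hc)
      ((continuous_of_mem_posTrigPoly hw').continuousOn.smul hc) (hwH t ht)
  | smul a q _ hq =>
    obtain ⟨G, hG, hqG⟩ := hq
    refine ⟨((a : ℝ) : ℂ) • G, Submodule.smul_mem _ _ hG, fun t ht => ?_⟩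
    have h := (hqG t ht).const_smul ((a : ℝ) : ℂ)
    convert h using 2 with s
    · rw [smul_smul, Pi.smul_apply, NNReal.smul_def, Complex.real_smul]
    · rfl

/-- An almost periodic function with mean value zero is a uniform limit of linear combinations of
almost anti-periodic functions. -/
lemma mem_ANP_of_hasMean_zero (hI : I = univ ∨ I = Ici (0 : ℝ)) (hf : IsAlmostPeriodic I f)
    (hf0 : HasMean f 0) : f ∈ ANP X I := by
  refine ⟨hf, fun ε hε => ?_⟩
  obtain ⟨C, hC⟩ := hf.exists_bound hI
  have hC0 : 0 ≤ C := (norm_nonneg _).trans (hC 0 (mem_of_nonneg hI le_rfl))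
  obtain ⟨S, hS⟩ := hf.exists_bohr_set hI (show 0 < ε / 2 by positivity)
  obtain ⟨Q, c, hQ, hQ0, hc, hQc, hsmall⟩ :=
    exists_kernel S (show 0 < ε / (4 * (C + 1)) by positivity)
  obtain ⟨G, hG, hGt⟩ := exists_hasMean_smul_of_mem_posTrigPoly hI hf hf0 hQ
  refine ⟨((c⁻¹ : ℝ) : ℂ) • G, Submodule.smul_mem _ _ hG, fun t ht => ?_⟩
  have hQcont : Continuous Q := by
    have := Complex.continuous_re.comp (continuous_of_mem_posTrigPoly hQ)
    exact this
  have hcont := (continuous_of_mem_posTrigPoly hQ).continuousOn.smul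
    (continuousOn_comp_add_left hI hf.1 ht)
  have hQf : HasMean (fun s => (Q s : ℂ) • f t) (c • f t) := by
    refine (Tendsto.smul_const hQc (f t)).congr fun T => ?_
    simp only [Complex.coe_smul]
    rw [intervalIntegral.integral_smul_const, smul_assoc]
  have h1 := (hGt t ht).sub hI hcont
    ((continuous_of_mem_posTrigPoly hQ).smul continuous_const).continuousOn hQf
  -- The majorant's first term covers `s` in the Bohr set, an `ε / 2`-period of `f`; the second
  -- covers the rest, where `Q` is small and `f` bounded.
  have h2 : HasMean (fun s => (ε / 2) * Q s + ε / 2 * c) ((ε / 2) * c + ε / 2 * c) :=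
    HasMean.add (.inl rfl) (continuous_const.mul hQcont).continuousOn continuousOn_const
      (hQc.const_smul (ε / 2)) (hasMean_const _)
  have h3 : ‖G t - c • f t‖ ≤ (ε / 2) * c + ε / 2 * c := by
    refine h1.norm_le_of_norm_le (.inl rfl)
      ((continuous_const.mul hQcont).add continuous_const).continuousOn h2 fun s hs => ?_
    have hsI := mem_of_nonneg hI hs
    change ‖(Q s : ℂ) • f (t + s) - (Q s : ℂ) • f t‖ ≤ ε / 2 * Q s + ε / 2 * c
    rw [← smul_sub, norm_smul, Complex.norm_real, Real.norm_of_nonneg (hQ0 s)]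
    by_cases hsS : ∃ r ∈ S, 1 / 4 ≤ ‖expChar r s - 1‖
    · have h4 : ‖f (t + s) - f t‖ ≤ 2 * (C + 1) := by
        have h5 := hC _ (add_mem_domain hI ht hsI)
        have h6 := hC _ ht
        linarith [norm_sub_le (f (t + s)) (f t)]
      have h5 := mul_le_mul (hsmall s hsS) h4 (norm_nonneg _) (by positivity)
      have h6 : ε / (4 * (C + 1)) * c * (2 * (C + 1)) = ε / 2 * c := by
        field_simp
        ring
      have h7 : 0 ≤ ε / 2 * Q s := mul_nonneg (by positivity) (hQ0 s)
      linarith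
    · push Not at hsS
      have h4 := mul_le_mul_of_nonneg_left (hS s hsI hsS t ht) (hQ0 s)
      have h5 : 0 ≤ ε / 2 * c := by positivity
      linarith
  have h4 : f t - (((c⁻¹ : ℝ) : ℂ) • G) t = -(c⁻¹ • (G t - c • f t)) := by
    rw [Pi.smul_apply, Complex.coe_smul, smul_sub, smul_smul, inv_mul_cancel₀ hc.ne', one_smul]
    abel
  rw [h4, norm_neg, norm_smul, Real.norm_of_nonneg (by positivity), inv_mul_le_iff₀ hc]
  linarith

end Approximation

end AlmostAnti

theorem corollary2p6 {X : Type*} [NormedAddCommGroup X] [NormedSpace ℂ X] [CompleteSpace X]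
    (I : Set ℝ) (hI : I = Set.univ ∨ I = Set.Ici (0 : ℝ))
    (f : ℝ → X) (hf : AlmostAnti.IsAlmostPeriodic I f)
    (Λ : Set ℝ) (hΛ : Λ.Nonempty) :
    f ∈ AlmostAnti.APSpec X I Λ ↔
      ∀ r : ℝ, r ∉ Λ →
        (fun t : ℝ => Complex.exp (-(Complex.I * r * t)) • f t) ∈ AlmostAnti.ANP X I := by
  simp only [AlmostAnti.exp_neg_eq_expChar]
  constructor
  · rintro ⟨-, hσ⟩ r hr
    have hfr := hf.expChar_smul hI (-r)
    -- `bohrSpectrum` records only frequencies whose limit exists, so existence of the mean is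
    -- needed before `r ∉ Λ` forces it to vanish.
    obtain ⟨p, hp⟩ := hfr.exists_hasMean hI
    have hp0 : p = 0 := by
      by_contra h
      exact hr (hσ ⟨p, AlmostAnti.isBohrTransform_iff.2 hp, h⟩)
    exact AlmostAnti.mem_ANP_of_hasMean_zero hI hfr (hp0 ▸ hp)
  · refine fun h => ⟨hf, ?_⟩
    rintro r ⟨p, hp, hp0⟩
    by_contra hr
    exact hp0 (AlmostAnti.eq_zero_of_mem_ANP hI (h r hr) (AlmostAnti.isBohrTransform_iff.1 hp))
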